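/- Let $k$ be a field with $\operatorname{char} k\neq 2$ and let $n\geq 4$ be an even integer. Let $W_n$ be the (associative, unital) $k$-algebra generated by $x_1,\dots,x_n$ subject to the relations $x_ix_j+x_jx_i=1$ for all $i\neq j$. Then there is a group isomorphism $\Phi\colon S_n\times\{\pm1\}\to\operatorname{Aut}(W_n)$ onto the full group of $k$-algebra automorphisms of $W_n$ such that $\Phi(\sigma,\varepsilon)(x_i)=\varepsilon\,x_{\sigma(i)}$ for all $\sigma\in S_n$, $\varepsilon\in\{\pm1\}$ and $1\leq i\leq n$. In other words, $\operatorname{Aut}(W_n)=S_n\times\{\pm1\}$, acting by permuting the generators and by a global sign. -/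

import Mathlib

/-- The defining relations `x_i x_j + x_j x_i = 1` (for `i ≠ j`) in the free algebra
`k⟨x_1, …, x_n⟩`. -/
inductive WRel (k : Type*) [Field k] (n : ℕ) :
    FreeAlgebra k (Fin n) → FreeAlgebra k (Fin n) → Prop
  | anticomm (i j : Fin n) (hij : i ≠ j) :
      WRel k n
        (FreeAlgebra.ι k i * FreeAlgebra.ι k j + FreeAlgebra.ι k j * FreeAlgebra.ι k i) 1

/-- The `k`-algebra `W_n` generated by `x_1, …, x_n` subject to `x_i x_j + x_j x_i = 1`
for all `i ≠ j`. -/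
abbrev WAlg (k : Type*) [Field k] (n : ℕ) : Type _ :=
  RingQuot (WRel k n)

/-- The generator `x_i` of `W_n`. -/
def WAlg.x (k : Type*) [Field k] (n : ℕ) (i : Fin n) : WAlg k n :=
  RingQuot.mkAlgHom k (WRel k n) (FreeAlgebra.ι k i)

/-! The ordered monomials form a basis of `W_n`: the generators act on commutative polynomials by
signed creation and annihilation operators, and acting on `1` gives a normal form
(`normalForm_injective`). Up to terms of lower degree the generators anticommute, so for the
degree-lexicographic order leading exponents add under multiplication and `W_n` is a domain
(`leadExp_mul`).

The rigidity comes from `omega`, an iterated signed commutator of the generators with leading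
exponent `(1, …, 1)`. For even `n` it anticommutes with every `x_i`, and every anticentral element
is a left multiple of it. Normal elements (here `u * W ⊆ W * u`) either commute or anticommute with
all generators, and `char k ≠ 2` excludes the first case for `φ omega`. Applying this to `φ` and to
its inverse gives `φ omega = z * omega` with `z` of leading exponent zero.

Since `φ omega` is also the iterated signed commutator of the `φ x_i`, the leading exponents of the
`φ x_i` sum to `(1, …, 1)`. None is zero, so they are the unit vectors in some order and each `φ
x_i` is affine. Comparing coefficients in the relations leaves `φ x_i = c_i x_{σ i}` with `c_i c_j =
1` for `i ≠ j`; three indices force a common sign. -/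

namespace WAlg

open MvPolynomial Finsupp

variable {k : Type*} [Field k] {n : ℕ}

/-! ### Creation and annihilation operators on polynomials -/

/-- The partial degree `∑_{l < i} a_l` of an exponent vector. -/
def partialDegree (i : Fin n) : (Fin n →₀ ℕ) →+ ℕ where
  toFun a := ∑ l ∈ Finset.Iio i, a l
  map_zero' := by simp
  map_add' a b := by simp [Finset.sum_add_distrib]

lemma partialDegree_single (i j : Fin n) (c : ℕ) :
    partialDegree i (single j c) = if j < i then c else 0 := by
  simp [partialDegree, Finsupp.single_apply]

variable (k) in
/-- The creation operator `x^a ↦ (-1)^{∑_{l < i} a_l} x^{a + e_i}`. -/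
noncomputable def creation (i : Fin n) : Module.End k (MvPolynomial (Fin n) k) :=
  (basisMonomials (Fin n) k).constr k fun a =>
    monomial (a + single i 1) ((-1) ^ partialDegree i a)

variable (k) in
/-- The annihilation operator, sending `x^a` to `(-1)^{∑_{l < i} a_l} x^{a - e_i}` if `a_i` is odd
and to zero otherwise. -/
noncomputable def annihilation (i : Fin n) : Module.End k (MvPolynomial (Fin n) k) :=
  (basisMonomials (Fin n) k).constr k fun a =>
    if Odd (a i) then monomial (a - single i 1) ((-1) ^ partialDegree i a) else 0

lemma creation_monomial (i : Fin n) (a : Fin n →₀ ℕ) (c : k) :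
    creation k i (monomial a c) = monomial (a + single i 1) ((-1) ^ partialDegree i a * c) := by
  have h : monomial a c = c • basisMonomials (Fin n) k a := by simp [smul_monomial]
  rw [h, map_smul, creation, Module.Basis.constr_basis, smul_monomial, smul_eq_mul, mul_comm]

lemma annihilation_monomial (i : Fin n) (a : Fin n →₀ ℕ) (c : k) :
    annihilation k i (monomial a c) =
      if Odd (a i) then monomial (a - single i 1) ((-1) ^ partialDegree i a * c) else 0 := by
  have h : monomial a c = c • basisMonomials (Fin n) k a := by simp [smul_monomial]
  rw [h, map_smul, annihilation, Module.Basis.constr_basis]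
  split_ifs <;> simp [smul_monomial, mul_comm]

lemma annihilation_monomial_add (i : Fin n) (a : Fin n →₀ ℕ) (c : k) :
    annihilation k i (monomial (a + single i 1) c) =
      if Even (a i) then monomial a ((-1) ^ partialDegree i a * c) else 0 := by
  rw [annihilation_monomial]
  simp [Nat.odd_add_one, partialDegree_single]

lemma annihilation_monomial_of_even (i : Fin n) (a : Fin n →₀ ℕ) (c : k) (h : Even (a i)) :
    annihilation k i (monomial a c) = 0 := by
  rw [annihilation_monomial, if_neg (Nat.not_odd_iff_even.2 h)]

lemma exists_eq_add_single_of_odd {a : Fin n →₀ ℕ} {i : Fin n} (h : Odd (a i)) :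
    ∃ b, a = b + single i 1 ∧ Even (b i) := by
  have h1 : single i 1 ≤ a := by
    rw [Finsupp.single_le_iff]; exact h.pos
  refine ⟨a - single i 1, (tsub_add_cancel_of_le h1).symm, ?_⟩
  simpa using h.tsub_odd odd_one

lemma end_ext {f g : Module.End k (MvPolynomial (Fin n) k)}
    (h : ∀ a, f (monomial a 1) = g (monomial a 1)) : f = g :=
  (basisMonomials (Fin n) k).ext fun a => by simpa using h a

/-- Raising the exponent of the smaller index changes the partial degree of the larger one by one,
while the converse has no effect; the two orders thus differ by one sign. -/
lemma creation_anticomm {i j : Fin n} (hij : i ≠ j) :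
    creation k i * creation k j + creation k j * creation k i = 0 := by
  refine end_ext fun a => ?_
  have e : a + single j 1 + single i 1 = a + single i 1 + single j 1 := add_right_comm _ _ _
  simp only [LinearMap.add_apply, Module.End.mul_apply, creation_monomial, LinearMap.zero_apply,
    map_add, partialDegree_single, e]
  rcases lt_or_gt_of_ne hij with h | h
  · rw [if_neg h.not_gt, if_pos h]
    rw [← map_add, MvPolynomial.monomial_eq_zero]; ring
  · rw [if_neg h.not_gt, if_pos h]
    rw [← map_add, MvPolynomial.monomial_eq_zero]; ring

/-- On each monomial exactly one summand is the identity and the other is zero, according to the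
parity of the exponent. This is why annihilation acts only on odd exponents. -/
lemma creation_annihilation_self (i : Fin n) :
    creation k i * annihilation k i + annihilation k i * creation k i = 1 := by
  refine end_ext fun a => ?_
  simp only [LinearMap.add_apply, Module.End.mul_apply, creation_monomial,
    annihilation_monomial_add, Module.End.one_apply]
  by_cases h : Even (a i)
  · rw [annihilation_monomial_of_even _ _ _ h]
    simp [h, ← pow_add]
  · obtain ⟨b, rfl, hb⟩ := exists_eq_add_single_of_odd (Nat.not_even_iff_odd.1 h)
    rw [annihilation_monomial_add]
    simp [hb, ← pow_add, creation_monomial]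

lemma creation_annihilation {i j : Fin n} (hij : i ≠ j) :
    creation k i * annihilation k j + annihilation k j * creation k i = 0 := by
  refine end_ext fun a => ?_
  simp only [LinearMap.add_apply, Module.End.mul_apply, creation_monomial, LinearMap.zero_apply]
  by_cases h : Even (a j)
  · rw [annihilation_monomial_of_even _ _ _ h, annihilation_monomial_of_even]
    · simp
    · simpa [Finsupp.single_apply, hij] using h
  · obtain ⟨b, rfl, hb⟩ := exists_eq_add_single_of_odd (Nat.not_even_iff_odd.1 h)
    have e : b + single j 1 + single i 1 = b + single i 1 + single j 1 := add_right_comm _ _ _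
    have hb' : Even ((b + single i 1 : Fin n →₀ ℕ) j) := by
        simpa [Finsupp.single_apply, hij] using hb
    rw [e, annihilation_monomial_add, annihilation_monomial_add, if_pos hb, if_pos hb',
      creation_monomial, ← map_add (monomial _), MvPolynomial.monomial_eq_zero]
    simp only [map_add, partialDegree_single]
    rcases lt_or_gt_of_ne hij with h | h
    · rw [if_neg h.not_gt, if_pos h]; ring
    · rw [if_neg h.not_gt, if_pos h]; ring

lemma annihilation_sq (i : Fin n) : annihilation k i * annihilation k i = 0 := by
  refine end_ext fun a => ?_
  simp only [Module.End.mul_apply, LinearMap.zero_apply]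
  by_cases h : Even (a i)
  · rw [annihilation_monomial_of_even _ _ _ h, map_zero]
  · obtain ⟨b, rfl, hb⟩ := exists_eq_add_single_of_odd (Nat.not_even_iff_odd.1 h)
    rw [annihilation_monomial_add, if_pos hb, annihilation_monomial_of_even _ _ _ hb]

lemma annihilation_anticomm (i j : Fin n) :
    annihilation k i * annihilation k j + annihilation k j * annihilation k i = 0 := by
  rcases eq_or_ne i j with rfl | hij
  · rw [annihilation_sq, add_zero]
  refine end_ext fun a => ?_
  simp only [LinearMap.add_apply, Module.End.mul_apply, LinearMap.zero_apply]
  by_cases hi : Even (a i)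
  · rw [annihilation_monomial_of_even _ _ _ hi, map_zero, add_zero]
    by_cases hj : Even (a j)
    · rw [annihilation_monomial_of_even _ _ _ hj, map_zero]
    · obtain ⟨b, rfl, hb⟩ := exists_eq_add_single_of_odd (Nat.not_even_iff_odd.1 hj)
      rw [annihilation_monomial_add, if_pos hb, annihilation_monomial_of_even]
      simpa [Finsupp.single_apply, hij.symm] using hi
  · obtain ⟨b, rfl, hb⟩ := exists_eq_add_single_of_odd (Nat.not_even_iff_odd.1 hi)
    rw [annihilation_monomial_add, if_pos hb]
    by_cases hj : Even (b j)
    · rw [annihilation_monomial_of_even _ _ _ hj, annihilation_monomial_of_even j]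
      · simp
      · simpa [Finsupp.single_apply, hij] using hj
    · obtain ⟨b, rfl, hb2⟩ := exists_eq_add_single_of_odd (Nat.not_even_iff_odd.1 hj)
      have e : b + single j 1 + single i 1 = b + single i 1 + single j 1 := add_right_comm _ _ _
      have hb' : Even ((b + single i 1 : Fin n →₀ ℕ) j) := by
        simpa [Finsupp.single_apply, hij] using hb2
      have hb3 : Even (b i) := by simpa [Finsupp.single_apply, hij.symm] using hb
      rw [annihilation_monomial_add, if_pos hb2, e, annihilation_monomial_add, if_pos hb',
        annihilation_monomial_add, if_pos hb3, ← map_add (monomial _),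
        MvPolynomial.monomial_eq_zero]
      simp only [map_add, partialDegree_single]
      rcases lt_or_gt_of_ne hij with h | h
      · rw [if_neg h.not_gt, if_pos h]; ring
      · rw [if_neg h.not_gt, if_pos h]; ring

variable (k) in
/-- The operator by which the generator `x_i` acts on polynomials. -/
noncomputable def genOp (i : Fin n) : Module.End k (MvPolynomial (Fin n) k) :=
  creation k i + ∑ j ∈ Finset.Iio i, annihilation k j

/-- Creation operators anticommute among themselves, and so do annihilation operators. A mixed
anticommutator is nonzero only for equal indices, so the sum over `j < i` in `genOp` contributes `1`
from exactly one of `i < m` and `m < i`. -/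
lemma genOp_anticomm {i m : Fin n} (him : i ≠ m) :
    genOp k i * genOp k m + genOp k m * genOp k i = 1 := by
  have key (p q : Fin n) : creation k p * (∑ j ∈ Finset.Iio q, annihilation k j) +
      (∑ j ∈ Finset.Iio q, annihilation k j) * creation k p = if p < q then 1 else 0 := by
    rw [Finset.mul_sum, Finset.sum_mul, ← Finset.sum_add_distrib]
    trans ∑ j ∈ Finset.Iio q, if p = j then 1 else 0
    · refine Finset.sum_congr rfl fun j _ => ?_
      split_ifs with h
      · rw [h, creation_annihilation_self]
      · rw [creation_annihilation h]
    · simp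
  have hDD : (∑ j ∈ Finset.Iio i, annihilation k j) * (∑ j ∈ Finset.Iio m, annihilation k j) +
      (∑ j ∈ Finset.Iio m, annihilation k j) * (∑ j ∈ Finset.Iio i, annihilation k j) = 0 := by
    rw [Finset.sum_mul_sum, Finset.sum_mul_sum, Finset.sum_comm, ← Finset.sum_add_distrib]
    refine Finset.sum_eq_zero fun j _ => ?_
    rw [← Finset.sum_add_distrib]
    exact Finset.sum_eq_zero fun l _ => annihilation_anticomm _ _
  have hs : (if i < m then 1 else 0 : Module.End k (MvPolynomial (Fin n) k)) +
      (if m < i then 1 else 0) = 1 := by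
    rcases lt_or_gt_of_ne him with h | h <;> simp [h, h.not_gt]
  rw [← hs, ← key, ← key]
  simp only [genOp, add_mul, mul_add]
  have h1 := creation_anticomm (k := k) him
  rw [add_eq_zero_iff_eq_neg] at h1 hDD
  rw [h1, hDD]
  abel

/-! ### Presentation, normal form and the basis of ordered monomials -/

lemma relation {i j : Fin n} (hij : i ≠ j) :
    x k n i * x k n j + x k n j * x k n i = 1 := by
  have := RingQuot.mkAlgHom_rel k (WRel.anticomm (k := k) i j hij)
  simpa [x] using this

/-- The universal property of `W_n`. -/
noncomputable def lift {B : Type*} [Ring B] [Algebra k B] (y : Fin n → B)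
    (hy : ∀ i j, i ≠ j → y i * y j + y j * y i = 1) : WAlg k n →ₐ[k] B :=
  RingQuot.liftAlgHom k ⟨FreeAlgebra.lift k y, by
    rintro _ _ ⟨i, j, hij⟩
    simpa using hy i j hij⟩

@[simp] lemma lift_x {B : Type*} [Ring B] [Algebra k B] (y : Fin n → B)
    (hy : ∀ i j, i ≠ j → y i * y j + y j * y i = 1) (i : Fin n) :
    lift (k := k) y hy (x k n i) = y i := by
  simp [lift, x]

lemma algHom_ext {B : Type*} [Semiring B] [Algebra k B] {f g : WAlg k n →ₐ[k] B}
    (h : ∀ i, f (x k n i) = g (x k n i)) : f = g :=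
  RingQuot.ringQuot_ext' k f g (FreeAlgebra.hom_ext (funext h))

lemma adjoin_range_x : Algebra.adjoin k (Set.range (x k n)) = ⊤ := by
  have h : Set.range (x k n) =
      RingQuot.mkAlgHom k (WRel k n) '' Set.range (FreeAlgebra.ι k) := by
    rw [← Set.range_comp]; rfl
  rw [h, ← AlgHom.map_adjoin, FreeAlgebra.adjoin_range_ι, Algebra.map_top,
    AlgHom.range_eq_top]
  exact RingQuot.mkAlgHom_surjective k _

/-- The action of `W_n` on polynomials. -/
noncomputable def act : WAlg k n →ₐ[k] Module.End k (MvPolynomial (Fin n) k) :=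
  lift (genOp k) fun _ _ h => genOp_anticomm h

/-- The normal form of an element of `W_n`, a commutative polynomial. -/
noncomputable def normalForm : WAlg k n →ₗ[k] MvPolynomial (Fin n) k :=
  LinearMap.applyₗ 1 ∘ₗ act.toLinearMap

lemma normalForm_apply (u : WAlg k n) : normalForm u = act u 1 := rfl

lemma normalForm_mul (u v : WAlg k n) : normalForm (u * v) = act u (normalForm v) := by
  simp [normalForm_apply]

lemma normalForm_x_mul (i : Fin n) (v : WAlg k n) :
    normalForm (x k n i * v) = genOp k i (normalForm v) := by
  simp [normalForm_mul, act]

/-- Annihilators of smaller indices kill the monomial and the sign is trivial, so applying an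
ordered monomial of `W_n` to `1` rebuilds the same commutative monomial. -/
lemma genOp_monomial_of_forall_lt (i : Fin n) (a : Fin n →₀ ℕ) (h : ∀ l < i, a l = 0) (c : k) :
    genOp k i (monomial a c) = monomial (a + single i 1) c := by
  have h1 : ∀ j ∈ Finset.Iio i, annihilation k j (monomial a c) = 0 := fun j hj =>
    annihilation_monomial_of_even _ _ _ (by simp [h j (Finset.mem_Iio.1 hj)])
  have h2 : partialDegree i a = 0 := Finset.sum_eq_zero fun j hj => h j (Finset.mem_Iio.1 hj)
  rw [genOp, LinearMap.add_apply, LinearMap.sum_apply, Finset.sum_eq_zero h1, creation_monomial, h2]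
  simp

variable (k) in
/-- The ordered monomial `x_0^{a_0} x_1^{a_1} ⋯`. -/
noncomputable def mon (a : Fin n →₀ ℕ) : WAlg k n :=
  ((toMultiset a).sort.map (x k n)).prod

@[simp] lemma mon_zero : mon k (0 : Fin n →₀ ℕ) = 1 := by simp [mon]

lemma mon_add_single (a : Fin n →₀ ℕ) (i : Fin n) (h : ∀ l < i, a l = 0) :
    mon k (a + single i 1) = x k n i * mon k a := by
  have h1 : toMultiset (a + single i 1) = i ::ₘ toMultiset a := by
    rw [toMultiset_add, toMultiset_single, one_smul, add_comm, Multiset.singleton_add]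
  rw [mon, h1, Multiset.sort_cons, List.map_cons, List.prod_cons, mon]
  intro b hb
  by_contra hlt
  rw [Finsupp.mem_toMultiset, Finsupp.mem_support_iff] at hb
  exact hb (h b (not_le.1 hlt))

/-- Induction on exponent vectors that inserts the smallest index last. -/
lemma exponent_induction {p : (Fin n →₀ ℕ) → Prop} (h0 : p 0)
    (hs : ∀ (a : Fin n →₀ ℕ) (i : Fin n), (∀ l < i, a l = 0) →
      (∀ b : Fin n →₀ ℕ, b.degree ≤ a.degree → p b) → p (a + single i 1))
    (a : Fin n →₀ ℕ) : p a := by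
  induction hd : a.degree using Nat.strong_induction_on generalizing a with
  | _ d ih =>
    rcases eq_or_ne a 0 with rfl | ha
    · exact h0
    have hne : a.support.Nonempty := Finsupp.support_nonempty_iff.2 ha
    set i := a.support.min' hne with hi
    have hia : a i ≠ 0 := Finsupp.mem_support_iff.1 (a.support.min'_mem hne)
    have h1 : single i 1 ≤ a := by
      rw [Finsupp.single_le_iff]; omega
    have h2 : a - single i 1 + single i 1 = a := tsub_add_cancel_of_le h1
    have h3 : (a - single i 1).degree + 1 = d := by
      rw [← hd]; conv_rhs => rw [← h2]
      simp
    rw [← h2]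
    refine hs _ _ (fun l hl => ?_) fun b hb => ih b.degree (by omega) b rfl
    have : a l = 0 := by
      by_contra h
      exact (a.support.min'_le l (Finsupp.mem_support_iff.2 h)).not_gt hl
    simp [this]

lemma normalForm_mon (a : Fin n →₀ ℕ) : normalForm (mon k a) = monomial a 1 := by
  induction a using exponent_induction with
  | h0 => simp [normalForm_apply]
  | hs a i h ih =>
    rw [mon_add_single a i h, normalForm_x_mul, ih a le_rfl, genOp_monomial_of_forall_lt i a h]

variable (k n) in
/-- The linear map sending each monomial to the corresponding ordered monomial of `W_n`. -/
noncomputable def ofPoly : MvPolynomial (Fin n) k →ₗ[k] WAlg k n :=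
  (basisMonomials (Fin n) k).constr k (mon k)

lemma ofPoly_monomial (a : Fin n →₀ ℕ) (c : k) : ofPoly k n (monomial a c) = c • mon k a := by
  have h : monomial a c = c • basisMonomials (Fin n) k a := by simp [smul_monomial]
  rw [h, map_smul, ofPoly, Module.Basis.constr_basis]

lemma ofPoly_genOp_of_min (i : Fin n) (f : MvPolynomial (Fin n) k)
    (h : ∀ a ∈ f.support, ∀ l < i, a l = 0) :
    ofPoly k n (genOp k i f) = x k n i * ofPoly k n f := by
  rw [f.as_sum, map_sum, map_sum, map_sum, Finset.mul_sum]
  refine Finset.sum_congr rfl fun a ha => ?_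
  rw [genOp_monomial_of_forall_lt _ _ (h a ha), ofPoly_monomial, ofPoly_monomial,
    mon_add_single _ _ (h a ha), mul_smul_comm]

/-- Exponents appearing in `x_i • x^a` vanish below `j` if those of `x^a` do and `j ≤ i`. -/
lemma support_genOp_monomial {i j : Fin n} (hij : j ≤ i) {a : Fin n →₀ ℕ}
    (h : ∀ l < j, a l = 0) (c : k) :
    ∀ b ∈ (genOp k i (monomial a c)).support, ∀ l < j, b l = 0 := by
  classical
  intro b hb l hl
  have hli : l ≠ i := (hl.trans_le hij).ne
  rw [genOp, LinearMap.add_apply, LinearMap.sum_apply] at hb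
  rcases Finset.mem_union.1 (MvPolynomial.support_add hb) with hb | hb
  · rw [creation_monomial] at hb
    have := Finset.mem_singleton.1 (support_monomial_subset hb)
    simp [this, h l hl, hli.symm]
  · obtain ⟨m, -, hm⟩ := Finset.mem_biUnion.1 (MvPolynomial.support_sum hb)
    rw [annihilation_monomial] at hm
    split_ifs at hm
    · have := Finset.mem_singleton.1 (support_monomial_subset hm)
      simp [this, h l hl]
    · simp at hm

/-- This is the straightening of `x_i x^a`. If `i` does not exceed the first index `j`, the product
is already ordered. Otherwise `x_i x_j = 1 - x_j x_i` is used both in `W_n` and for the operators,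
and the two sides agree by induction. -/
lemma ofPoly_genOp_monomial (i : Fin n) (a : Fin n →₀ ℕ) :
    ofPoly k n (genOp k i (monomial a 1)) = x k n i * mon k a := by
  induction a using exponent_induction with
  | h0 =>
    rw [ofPoly_genOp_of_min, ofPoly_monomial, one_smul]
    intro a ha l hl
    rw [Finset.mem_singleton.1 (support_monomial_subset ha)]; rfl
  | hs a j h ih =>
    rcases le_or_gt i j with hij | hij
    · rw [ofPoly_genOp_of_min, ofPoly_monomial, one_smul]
      intro b hb l hl
      rw [Finset.mem_singleton.1 (support_monomial_subset hb)]
      simp [h l (hl.trans_le hij), (hl.trans_le hij).ne']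
    · rw [mon_add_single a j h, ← genOp_monomial_of_forall_lt j a h, ← mul_assoc,
        eq_sub_of_add_eq (relation (k := k) hij.ne'), sub_mul, one_mul, mul_assoc,
        ← ih a le_rfl, ← ofPoly_genOp_of_min j _ (support_genOp_monomial hij.le h 1),
        ← Module.End.mul_apply, eq_sub_of_add_eq (genOp_anticomm (k := k) hij.ne'),
        LinearMap.sub_apply, map_sub, Module.End.one_apply, ofPoly_monomial, one_smul,
        Module.End.mul_apply]

lemma ofPoly_genOp (i : Fin n) (f : MvPolynomial (Fin n) k) :
    ofPoly k n (genOp k i f) = x k n i * ofPoly k n f := by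
  have : ofPoly k n ∘ₗ genOp k i = LinearMap.mulLeft k (x k n i) ∘ₗ ofPoly k n :=
    (basisMonomials (Fin n) k).ext fun a => by
      simp [ofPoly_genOp_monomial, ofPoly_monomial]
  exact LinearMap.congr_fun this f

lemma ofPoly_act (u : WAlg k n) (f : MvPolynomial (Fin n) k) :
    ofPoly k n (act u f) = u * ofPoly k n f := by
  have hu : u ∈ Algebra.adjoin k (Set.range (x k n)) := by rw [adjoin_range_x]; trivial
  induction hu using Algebra.adjoin_induction generalizing f with
  | mem u hu =>
    obtain ⟨i, rfl⟩ := hu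
    rw [act, lift_x, ofPoly_genOp]
  | algebraMap r =>
    rw [AlgHom.commutes, Module.algebraMap_end_apply, map_smul, Algebra.smul_def]
  | add u v _ _ hu hv => simp [hu, hv, add_mul]
  | mul u v _ _ hu hv => simp [hu, hv, mul_assoc]

/-- The spanning half of the basis theorem: `ofPoly` intertwines the two actions and sends `1` to
`1`. Independence is `normalForm_mon`. -/
lemma ofPoly_normalForm (u : WAlg k n) : ofPoly k n (normalForm u) = u := by
  have h : ofPoly k n 1 = 1 := by
    rw [← MvPolynomial.C_1, ← monomial_zero', ofPoly_monomial, mon_zero, one_smul]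
  rw [normalForm_apply, ofPoly_act, h, mul_one]

lemma normalForm_injective : Function.Injective (normalForm (k := k) (n := n)) :=
  Function.LeftInverse.injective ofPoly_normalForm

/-! ### Leading terms and the absence of zero divisors -/

open MonomialOrder

/-- The exponent of the sign in `x^a x^b = ± x^{a+b} + ⋯`. -/
noncomputable def inversions (a b : Fin n →₀ ℕ) : ℕ := ∑ i, a i * partialDegree i b

@[simp] lemma inversions_zero_left (b : Fin n →₀ ℕ) : inversions 0 b = 0 := by simp [inversions]

@[simp] lemma inversions_zero_right (b : Fin n →₀ ℕ) : inversions b 0 = 0 := by simp [inversions]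

lemma inversions_add_left (a a' b : Fin n →₀ ℕ) :
    inversions (a + a') b = inversions a b + inversions a' b := by
  simp [inversions, add_mul, Finset.sum_add_distrib]

lemma inversions_add_right (a b b' : Fin n →₀ ℕ) :
    inversions a (b + b') = inversions a b + inversions a b' := by
  simp [inversions, mul_add, Finset.sum_add_distrib]

lemma inversions_single_left (i : Fin n) (b : Fin n →₀ ℕ) :
    inversions (single i 1) b = partialDegree i b := by
  simp [inversions, Finsupp.single_apply]

/-- The two inversion numbers count the exponents below and above `i`. Hence the sign for exchanging
`x_i` and `x^a` has the parity of `a.degree - a i`. -/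
lemma inversions_single_add (i : Fin n) (a : Fin n →₀ ℕ) :
    inversions (single i 1) a + inversions a (single i 1) + a i = a.degree := by
  have h1 : inversions a (single i 1) = ∑ l ∈ Finset.Ioi i, a l := by
    simp only [inversions, partialDegree_single, mul_ite, mul_one, mul_zero]
    rw [← Finset.sum_filter]
    exact Finset.sum_congr (by ext; simp) fun _ _ => rfl
  have h2 : (Finset.univ : Finset (Fin n)) = Finset.Iio i ∪ Finset.Ioi i ∪ {i} := by
    ext j; rcases lt_trichotomy j i with h | h | h <;> simp [h, h.le]
  rw [inversions_single_left, h1, Finsupp.degree_eq_sum, h2, Finset.sum_union, Finset.sum_union]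
  · simp [partialDegree]
  · rw [Finset.disjoint_left]
    intro j; simp only [Finset.mem_Iio, Finset.mem_Ioi]; exact fun h => h.not_gt
  · simp

variable (k n) in
/-- Polynomials of total degree less than `d`. -/
def polyDegreeLT (d : ℕ) : Submodule k (MvPolynomial (Fin n) k) where
  carrier := {p | ∀ c : Fin n →₀ ℕ, d ≤ c.degree → p.coeff c = 0}
  zero_mem' := by simp
  add_mem' hp hq c hc := by rw [coeff_add, hp c hc, hq c hc, add_zero]
  smul_mem' r p hp c hc := by rw [coeff_smul, hp c hc, smul_zero]

lemma polyDegreeLT_mono {d e : ℕ} (h : d ≤ e) : polyDegreeLT k n d ≤ polyDegreeLT k n e :=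
  fun _ hp c hc => hp c (h.trans hc)

lemma monomial_mem_polyDegreeLT {d : ℕ} {a : Fin n →₀ ℕ} (h : a.degree < d) (c : k) :
    monomial a c ∈ polyDegreeLT k n d := by
  classical
  intro b hb
  rw [coeff_monomial, if_neg]
  rintro rfl
  omega

lemma genOp_monomial_sub_mem (i : Fin n) (a : Fin n →₀ ℕ) (c : k) :
    genOp k i (monomial a c) - monomial (a + single i 1) ((-1) ^ partialDegree i a * c) ∈
      polyDegreeLT k n (a.degree + 1) := by
  rw [genOp, LinearMap.add_apply, LinearMap.sum_apply, creation_monomial, add_sub_cancel_left]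
  refine Submodule.sum_mem _ fun j _ => ?_
  rw [annihilation_monomial]
  split_ifs
  · exact monomial_mem_polyDegreeLT (Nat.lt_succ_of_le (degree_mono tsub_le_self)) _
  · exact Submodule.zero_mem _

lemma genOp_mem_polyDegreeLT (i : Fin n) {d : ℕ} {p : MvPolynomial (Fin n) k}
    (hp : p ∈ polyDegreeLT k n d) : genOp k i p ∈ polyDegreeLT k n (d + 1) := by
  rw [p.as_sum, map_sum]
  refine Submodule.sum_mem _ fun a ha => ?_
  have had : a.degree < d := by
    by_contra h
    exact MvPolynomial.mem_support_iff.1 ha (hp a (not_lt.1 h))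
  have h := polyDegreeLT_mono (e := d + 1) (by omega) (genOp_monomial_sub_mem i a (p.coeff a))
  have h' : monomial (a + single i 1) ((-1) ^ partialDegree i a * p.coeff a) ∈
      polyDegreeLT k n (d + 1) := monomial_mem_polyDegreeLT (by simpa using had) _
  simpa using Submodule.add_mem _ h h'

/-- The associated graded algebra is a skew polynomial ring: annihilation terms never reach the top
degree, and the creation terms contribute one sign per inversion. -/
lemma act_mon_monomial_sub_mem (a b : Fin n →₀ ℕ) :
    act (mon k a) (monomial b 1) - monomial (a + b) ((-1) ^ inversions a b) ∈
      polyDegreeLT k n (a.degree + b.degree) := by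
  induction a using exponent_induction with
  | h0 => simp
  | hs a i h ih =>
    have h1 := genOp_mem_polyDegreeLT i (ih a le_rfl)
    have h2 := genOp_monomial_sub_mem i (a + b) ((-1 : k) ^ inversions a b)
    have h3 : partialDegree i a = 0 := Finset.sum_eq_zero fun j hj => h j (Finset.mem_Iio.1 hj)
    have h4 : act (mon k (a + single i 1)) (monomial b 1) =
        genOp k i (act (mon k a) (monomial b 1)) := by
      rw [mon_add_single a i h, map_mul, Module.End.mul_apply, act, lift_x]
    rw [map_add (partialDegree i), h3, zero_add, ← pow_add, map_add Finsupp.degree] at h2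
    rw [map_sub] at h1
    have h5 := Submodule.add_mem _ h1 (polyDegreeLT_mono (by omega) h2)
    rw [sub_add_sub_cancel, ← h4] at h5
    rw [inversions_add_left, inversions_single_left, add_comm (inversions a b),
      add_right_comm a, map_add Finsupp.degree a, degree_single, add_right_comm a.degree]
    exact h5

/-- `A` and `B` are only upper bounds for the exponents. At or above `A + B`, the pair `(A, B)`
alone can contribute, because lower-degree remainders lie strictly below and addition is strictly
monotone. -/
lemma coeff_normalForm_mul {u v : WAlg k n} {A B c : Fin n →₀ ℕ}
    (hu : degLex.degree (normalForm u) ≼[degLex] A) (hv : degLex.degree (normalForm v) ≼[degLex] B)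
    (hc : (A + B) ≼[degLex] c) :
    (normalForm (u * v)).coeff c =
      if c = A + B then (-1) ^ inversions A B * (normalForm u).coeff A * (normalForm v).coeff B
      else 0 := by
  classical
  have hA : ∀ a ∈ (normalForm u).support, a ≼[degLex] A := fun a ha =>
    (degLex.le_degree ha).trans hu
  have hB : ∀ b ∈ (normalForm v).support, b ≼[degLex] B := fun b hb =>
    (degLex.le_degree hb).trans hv
  have hsum : normalForm (u * v) = ∑ a ∈ (normalForm u).support, ∑ b ∈ (normalForm v).support,
      ((normalForm u).coeff a * (normalForm v).coeff b) • act (mon k a) (monomial b 1) := by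
    have h1 : u = ∑ a ∈ (normalForm u).support, (normalForm u).coeff a • mon k a := by
      conv_lhs => rw [← ofPoly_normalForm u, (normalForm u).as_sum, map_sum]
      exact Finset.sum_congr rfl fun a _ => ofPoly_monomial _ _
    have h2 : normalForm v = ∑ b ∈ (normalForm v).support,
        (normalForm v).coeff b • monomial b (1 : k) := by
      conv_lhs => rw [(normalForm v).as_sum]
      simp [smul_monomial]
    rw [normalForm_mul]
    conv_lhs => rw [h1, h2]
    simp only [map_sum, map_smul, LinearMap.sum_apply, LinearMap.smul_apply, Finset.smul_sum,
      smul_smul]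
    rw [Finset.sum_comm]
    simp only [mul_comm]
  have hterm : ∀ a ∈ (normalForm u).support, ∀ b ∈ (normalForm v).support,
      (act (mon k a) (monomial b 1)).coeff c = if a + b = c then (-1) ^ inversions a b else 0 := by
    intro a ha b hb
    have h1 : (a + b) ≼[degLex] c := by
      refine le_trans ?_ hc
      rw [map_add, map_add]
      exact add_le_add (hA a ha) (hB b hb)
    have h2 : a.degree + b.degree ≤ c.degree := by
      rw [← map_add]; exact DegLex.monotone_degree h1
    have h3 := act_mon_monomial_sub_mem (k := k) a b c h2
    rwa [coeff_sub, coeff_monomial, sub_eq_zero] at h3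
  have heq : ∀ a ∈ (normalForm u).support, ∀ b ∈ (normalForm v).support, a + b = c →
      a = A ∧ b = B := by
    intro a ha b hb hab
    rw [← hab, map_add, map_add] at hc
    have h1 := hA a ha
    have h2 := hB b hb
    constructor
    · refine degLex.toSyn.injective (le_antisymm h1 ?_)
      by_contra h
      exact (add_lt_add_of_lt_of_le (not_le.1 h) h2).not_ge hc
    · refine degLex.toSyn.injective (le_antisymm h2 ?_)
      by_contra h
      exact (add_lt_add_of_le_of_lt h1 (not_le.1 h)).not_ge hc
  rw [hsum, coeff_sum]
  simp only [coeff_sum, coeff_smul, smul_eq_mul]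
  have hz : ∀ a ∈ (normalForm u).support, ∀ b ∈ (normalForm v).support, ¬ (a = A ∧ b = B) →
      (normalForm u).coeff a * (normalForm v).coeff b * (act (mon k a) (monomial b 1)).coeff c
        = 0 := by
    intro a ha b hb h
    rw [hterm a ha b hb, if_neg fun h' => h (heq a ha b hb h'), mul_zero]
  rw [Finset.sum_eq_single A, Finset.sum_eq_single B]
  · by_cases h1 : A ∈ (normalForm u).support
    · by_cases h2 : B ∈ (normalForm v).support
      · rw [hterm A h1 B h2]
        by_cases h : c = A + B
        · rw [if_pos h, if_pos h.symm]; ring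
        · rw [if_neg h, if_neg (Ne.symm h), mul_zero]
      · simp [MvPolynomial.notMem_support_iff.1 h2]
    · simp [MvPolynomial.notMem_support_iff.1 h1]
  · intro b hb hne
    by_cases h1 : A ∈ (normalForm u).support
    · exact hz A h1 b hb fun h => hne h.2
    · simp [MvPolynomial.notMem_support_iff.1 h1]
  · intro h; simp [MvPolynomial.notMem_support_iff.1 h]
  · exact fun a ha hne => Finset.sum_eq_zero fun b hb => hz a ha b hb fun h => hne h.1
  · intro h; simp [MvPolynomial.notMem_support_iff.1 h]

/-- The leading exponent of an element of `W_n`. -/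
noncomputable def leadExp (u : WAlg k n) : Fin n →₀ ℕ := degLex.degree (normalForm u)

/-- The leading coefficient of an element of `W_n`. -/
noncomputable def leadCoeff (u : WAlg k n) : k := (normalForm u).coeff (leadExp u)

lemma normalForm_eq_zero {u : WAlg k n} : normalForm u = 0 ↔ u = 0 :=
  map_eq_zero_iff _ normalForm_injective

lemma leadCoeff_ne_zero {u : WAlg k n} (hu : u ≠ 0) : leadCoeff u ≠ 0 :=
  degLex.coeff_degree_ne_zero_iff.2 (normalForm_eq_zero.not.2 hu)

lemma coeff_eq_zero_of_leadExp_lt {u : WAlg k n} {c : Fin n →₀ ℕ} (h : leadExp u ≺[degLex] c) :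
    (normalForm u).coeff c = 0 := degLex.coeff_eq_zero_of_lt h

lemma leadExp_eq {u : WAlg k n} {a : Fin n →₀ ℕ} (h : (normalForm u).coeff a ≠ 0)
    (h' : ∀ c, a ≺[degLex] c → (normalForm u).coeff c = 0) : u ≠ 0 ∧ leadExp u = a := by
  refine ⟨fun h0 => h (by simp [h0]), degLex.toSyn.injective (le_antisymm ?_ ?_)⟩
  · refine degLex.degree_le_iff.2 fun c hc => ?_
    by_contra hlt
    exact MvPolynomial.mem_support_iff.1 hc (h' c (not_le.1 hlt))
  · exact degLex.le_degree (MvPolynomial.mem_support_iff.2 h)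

lemma coeff_mul_leadExp (u v : WAlg k n) :
    (normalForm (u * v)).coeff (leadExp u + leadExp v) =
      (-1) ^ inversions (leadExp u) (leadExp v) * leadCoeff u * leadCoeff v := by
  rw [coeff_normalForm_mul (A := leadExp u) (B := leadExp v) le_rfl le_rfl le_rfl, if_pos rfl]; rfl

lemma coeff_mul_of_lt {u v : WAlg k n} {c : Fin n →₀ ℕ}
    (h : (leadExp u + leadExp v) ≺[degLex] c) : (normalForm (u * v)).coeff c = 0 := by
  rw [coeff_normalForm_mul (A := leadExp u) (B := leadExp v) le_rfl le_rfl h.le, if_neg]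
  rintro rfl
  exact lt_irrefl _ h

lemma mul_ne_zero_and_leadExp_mul {u v : WAlg k n} (hu : u ≠ 0) (hv : v ≠ 0) :
    u * v ≠ 0 ∧ leadExp (u * v) = leadExp u + leadExp v := by
  refine leadExp_eq ?_ fun c hc => coeff_mul_of_lt hc
  rw [coeff_mul_leadExp]
  exact mul_ne_zero (mul_ne_zero (pow_ne_zero _ (by simp)) (leadCoeff_ne_zero hu))
    (leadCoeff_ne_zero hv)

instance : NoZeroDivisors (WAlg k n) where
  eq_zero_or_eq_zero_of_mul_eq_zero {u v} h := by
    by_contra! hne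
    exact (mul_ne_zero_and_leadExp_mul hne.1 hne.2).1 h

lemma leadExp_mul {u v : WAlg k n} (hu : u ≠ 0) (hv : v ≠ 0) :
    leadExp (u * v) = leadExp u + leadExp v := (mul_ne_zero_and_leadExp_mul hu hv).2

lemma normalForm_one : normalForm (1 : WAlg k n) = monomial 0 1 := by
  rw [← mon_zero, normalForm_mon]

instance : Nontrivial (WAlg k n) where
  exists_pair_ne := ⟨1, 0, fun h => by
    have := normalForm_one (k := k) (n := n)
    rw [h, map_zero, eq_comm, MvPolynomial.monomial_eq_zero] at this
    exact one_ne_zero this⟩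

lemma leadExp_of_normalForm_eq_monomial {u : WAlg k n} {a : Fin n →₀ ℕ} {c : k} (hc : c ≠ 0)
    (h : normalForm u = monomial a c) : leadExp u = a := by
  classical
  rw [leadExp, h, degLex.degree_monomial, if_neg hc]

lemma leadExp_one : leadExp (1 : WAlg k n) = 0 :=
  leadExp_of_normalForm_eq_monomial one_ne_zero normalForm_one

lemma normalForm_x (i : Fin n) : normalForm (x k n i) = monomial (single i 1) 1 := by
  rw [← mul_one (x k n i), normalForm_x_mul, normalForm_one,
    genOp_monomial_of_forall_lt _ _ (by simp), zero_add]

lemma normalForm_x_mul_x (i : Fin n) :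
    normalForm (x k n i * x k n i) = monomial (single i 2) 1 := by
  rw [normalForm_x_mul, normalForm_x, genOp_monomial_of_forall_lt, ← single_add]
  intro l hl
  simp [hl.ne']

lemma leadExp_x (i : Fin n) : leadExp (x k n i) = single i 1 :=
  leadExp_of_normalForm_eq_monomial one_ne_zero (normalForm_x i)

lemma x_ne_zero (i : Fin n) : x k n i ≠ 0 := fun h => by
  have := normalForm_x (k := k) i
  rw [h, map_zero, eq_comm, MvPolynomial.monomial_eq_zero] at this
  exact one_ne_zero this

lemma normalForm_algebraMap (c : k) :
    normalForm (algebraMap k (WAlg k n) c) = monomial 0 c := by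
  rw [Algebra.algebraMap_eq_smul_one, map_smul, normalForm_one, smul_monomial, smul_eq_mul, mul_one]

lemma eq_algebraMap_of_leadExp_eq_zero {u : WAlg k n} (h : leadExp u = 0) :
    ∃ c : k, u = algebraMap k _ c := by
  refine ⟨degLex.leadingCoeff (normalForm u),
    normalForm_injective ((degLex.eq_C_of_degree_eq_zero h).trans ?_)⟩
  rw [normalForm_algebraMap]
  rfl

lemma normalForm_affine (β : k) (α : Fin n → k) :
    normalForm (algebraMap k _ β + ∑ i, α i • x k n i) =
      monomial 0 β + ∑ i, monomial (single i 1) (α i) := by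
  simp only [map_add, normalForm_algebraMap, map_sum, map_smul, normalForm_x, smul_monomial,
    smul_eq_mul, mul_one]

lemma exists_affine_of_degree_le_one {u : WAlg k n} (h : (leadExp u).degree ≤ 1) :
    ∃ (β : k) (α : Fin n → k), u = algebraMap k _ β + ∑ i, α i • x k n i ∧
      ∀ i, α i = (normalForm u).coeff (single i 1) := by
  classical
  refine ⟨(normalForm u).coeff 0, fun i => (normalForm u).coeff (single i 1),
    normalForm_injective ?_, fun _ => rfl⟩
  rw [normalForm_affine]
  ext c
  simp only [coeff_add, coeff_sum, coeff_monomial]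
  by_cases h0 : c = 0
  · subst h0
    simp
  by_cases h1 : c.degree = 1
  · obtain ⟨i, rfl⟩ : ∃ i, single i 1 = c := by
      have : c ∈ Set.range (fun a : Fin n ↦ Finsupp.single a 1) := by
        rw [Finsupp.range_single_one]; exact h1
      exact this
    rw [if_neg (Ne.symm h0)]
    simp [Finsupp.single_left_inj one_ne_zero]
  -- Here `c` has degree at least two, hence exceeds the leading exponent because the order compares
  -- degrees first.
  · rw [if_neg (Ne.symm h0), Finset.sum_eq_zero, add_zero]
    · refine coeff_eq_zero_of_leadExp_lt (not_le.1 fun hle => ?_)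
      have : c.degree ≤ (leadExp u).degree := DegLex.monotone_degree hle
      have := (degree_eq_zero_iff c).not.2 h0
      omega
    · intro i _
      rw [if_neg]
      rintro rfl
      simp at h1

end WAlg

/-! ### Iterated signed commutators -/

section wedge

variable {R : Type*} [Ring R]

/-- The iterated signed commutator of a list of elements; for pairwise anticommuting elements it is
a power of two times their product. -/
def wedge : List R → R
  | [] => 1
  | y :: l => y * wedge l + (-1) ^ l.length * (wedge l * y)

lemma commute_wedge {c : R} : ∀ l : List R, (∀ y ∈ l, Commute c y) → Commute c (wedge l)
  | [], _ => Commute.one_right c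
  | y :: l, h => by
    have hy := h y (by simp)
    have hl := commute_wedge l fun z hz => h z (by simp [hz])
    have hs : Commute c ((-1) ^ l.length) := (Commute.neg_one_right c).pow_right _
    exact (hy.mul_right hl).add_right (hs.mul_right (hl.mul_right hy))

lemma sq_commute_of_add_eq_one {y z : R} (h : y * z + z * y = 1) : Commute (y * y) z := by
  have h1 : y * z = 1 - z * y := eq_sub_of_add_eq h
  change y * y * z = z * (y * y)
  rw [mul_assoc, h1, mul_sub, mul_one, ← mul_assoc, h1, sub_mul, one_mul, sub_sub_cancel, mul_assoc]

/-- If `z` is the head, the claim reduces to `z * z` commuting with the tail. Otherwise `z` is moved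
through using `y * z = 1 - z * y`; the sign in `wedge` makes the inhomogeneous terms `wedge l`
cancel. -/
lemma wedge_mul : ∀ l : List R, l.Pairwise (fun y z => y * z + z * y = 1) →
    ∀ z ∈ l, wedge l * z = (-1) ^ (l.length + 1) * (z * wedge l)
  | [], _, z, hz => by simp at hz
  | y :: l, h, z, hz => by
    rw [List.pairwise_cons] at h
    have hc : y * y * wedge l = wedge l * (y * y) :=
      commute_wedge l fun z hz => sq_commute_of_add_eq_one (h.1 z hz)
    have ih := wedge_mul l h.2
    rcases List.mem_cons.1 hz with rfl | hz
    · rcases neg_one_pow_eq_or R l.length with hs | hs <;>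
        simp only [wedge, List.length_cons, pow_succ, hs] <;> noncomm_ring <;>
        rw [← mul_assoc z z, hc]
    · have h1 : y * z = 1 - z * y := eq_sub_of_add_eq (h.1 z hz)
      have h2 := ih z hz
      rcases neg_one_pow_eq_or R l.length with hs | hs
      · have h3 : wedge l * z = - (z * wedge l) := by rw [h2, pow_succ, hs]; noncomm_ring
        simp only [wedge, List.length_cons, pow_succ, hs]
        calc (y * wedge l + 1 * (wedge l * y)) * z
            = y * (wedge l * z) + wedge l * (y * z) := by noncomm_ring
          _ = y * -(z * wedge l) + wedge l * (1 - z * y) := by rw [h3, h1]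
          _ = - ((y * z) * wedge l) + wedge l - (wedge l * z) * y := by noncomm_ring
          _ = - ((1 - z * y) * wedge l) + wedge l - -(z * wedge l) * y := by rw [h1, h3]
          _ = _ := by noncomm_ring
      · have h3 : wedge l * z = z * wedge l := by rw [h2, pow_succ, hs]; noncomm_ring
        simp only [wedge, List.length_cons, pow_succ, hs]
        calc (y * wedge l + -1 * (wedge l * y)) * z
            = y * (wedge l * z) - wedge l * (y * z) := by noncomm_ring
          _ = y * (z * wedge l) - wedge l * (1 - z * y) := by rw [h3, h1]
          _ = (y * z) * wedge l - wedge l + (wedge l * z) * y := by noncomm_ring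
          _ = (1 - z * y) * wedge l - wedge l + (z * wedge l) * y := by rw [h1, h3]
          _ = _ := by noncomm_ring

lemma wedge_mul_add_mul_wedge {l : List R} (h : l.Pairwise (fun y z => y * z + z * y = 1))
    (hl : Even l.length) {z : R} (hz : z ∈ l) : wedge l * z + z * wedge l = 0 := by
  rw [wedge_mul l h z hz, hl.add_one.neg_one_pow, neg_one_mul, neg_add_cancel]

lemma map_wedge {S F : Type*} [Ring S] [FunLike F R S] [RingHomClass F R S] (f : F) :
    ∀ l : List R, f (wedge l) = wedge (l.map f)
  | [] => by simp [wedge]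
  | y :: l => by simp [wedge, map_wedge f l]

end wedge

lemma neg_one_pow_mul_eq_smul (k : Type*) {A : Type*} [CommRing k] [Ring A] [Algebra k A] (m : ℕ)
    (u : A) : (-1) ^ m * u = ((-1 : k) ^ m) • u := by
  rcases Nat.even_or_odd m with h | h <;> simp [h.neg_one_pow]

lemma neg_one_pow_add_neg_one_pow {k : Type*} [Field k] (h2 : (2 : k) ≠ 0) {p q : ℕ} :
    (-1 : k) ^ p + (-1) ^ q = 0 ↔ Odd (p + q) := by
  have h2' : (-1 : k) + -1 ≠ 0 := by
    rwa [← neg_add, neg_ne_zero, one_add_one_eq_two]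
  have h2'' : (1 : k) + 1 ≠ 0 := by rwa [one_add_one_eq_two]
  rcases Nat.even_or_odd p with hp | hp <;> rcases Nat.even_or_odd q with hq | hq
  · simp [hp.neg_one_pow, hq.neg_one_pow, h2'', hp.add hq]
  · simp [hp.neg_one_pow, hq.neg_one_pow, hp.add_odd hq]
  · simp [hp.neg_one_pow, hq.neg_one_pow, hp.add_even hq]
  · simp [hp.neg_one_pow, hq.neg_one_pow, h2', hp.add_odd hq]

/-! ### The element `omega` and anticentral elements -/

namespace WAlg

open MvPolynomial Finsupp MonomialOrder

variable {k : Type*} [Field k] {n : ℕ}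

/-- The coefficient in question is the product of the leading coefficients times a sum of two signs,
which vanishes in characteristic other than two only if the signs are opposite. -/
lemma odd_inversions_of_coeff_eq_zero (h2 : (2 : k) ≠ 0) {u v : WAlg k n} (hu : u ≠ 0)
    (hv : v ≠ 0) (h : (normalForm (u * v + v * u)).coeff (leadExp u + leadExp v) = 0) :
    Odd (inversions (leadExp u) (leadExp v) + inversions (leadExp v) (leadExp u)) := by
  rw [map_add, coeff_add, coeff_mul_leadExp, add_comm (leadExp u), coeff_mul_leadExp] at h
  rw [← neg_one_pow_add_neg_one_pow h2]
  have h3 : ((-1 : k) ^ inversions (leadExp u) (leadExp v) +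
      (-1) ^ inversions (leadExp v) (leadExp u)) * (leadCoeff u * leadCoeff v) = 0 := by
    rw [← h]; ring
  exact (mul_eq_zero.1 h3).resolve_right
    (mul_ne_zero (leadCoeff_ne_zero hu) (leadCoeff_ne_zero hv))

lemma odd_inversions_of_add_eq_one (h2 : (2 : k) ≠ 0) {u v : WAlg k n} (hu : u ≠ 0) (hv : v ≠ 0)
    (hu' : leadExp u ≠ 0) (h : u * v + v * u = 1) :
    Odd (inversions (leadExp u) (leadExp v) + inversions (leadExp v) (leadExp u)) := by
  classical
  refine odd_inversions_of_coeff_eq_zero h2 hu hv ?_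
  rw [h, normalForm_one, coeff_monomial, if_neg]
  intro h0
  exact hu' (add_eq_zero.1 h0.symm).1

lemma even_inversions_sum_add_length (a : Fin n →₀ ℕ) : ∀ l : List (Fin n →₀ ℕ),
    (∀ b ∈ l, Odd (inversions a b + inversions b a)) →
      Even (inversions a l.sum + inversions l.sum a + l.length)
  | [], _ => by simp
  | b :: l, h => by
    have h1 := h b (by simp)
    have h2 := even_inversions_sum_add_length a l fun c hc => h c (by simp [hc])
    rw [List.sum_cons, inversions_add_left, inversions_add_right, List.length_cons]
    obtain ⟨r, hr⟩ := h2.add (h1.add_odd odd_one)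
    exact ⟨r, by omega⟩

/-- The sign in `wedge` matches the sign with which the leading terms of `y` and `wedge l` commute,
so the two summands add up to twice one of them instead of cancelling. -/
lemma leadExp_wedge (h2 : (2 : k) ≠ 0) : ∀ l : List (WAlg k n),
    l.Pairwise (fun y z => y * z + z * y = 1) → (∀ y ∈ l, y ≠ 0 ∧ leadExp y ≠ 0) →
      wedge l ≠ 0 ∧ leadExp (wedge l) = (l.map leadExp).sum
  | [], _, _ => by simp [wedge, leadExp_one]
  | y :: l, h, h0 => by
    rw [List.pairwise_cons] at h
    obtain ⟨hw, hl⟩ := leadExp_wedge h2 l h.2 fun z hz => h0 z (by simp [hz])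
    obtain ⟨hy, hy0⟩ := h0 y (by simp)
    have hpar := even_inversions_sum_add_length (leadExp y) (l.map leadExp) (by
      intro b hb
      obtain ⟨z, hz, rfl⟩ := List.mem_map.1 hb
      exact odd_inversions_of_add_eq_one h2 hy (h0 z (by simp [hz])).1 hy0 (h.1 z hz))
    rw [← hl, List.length_map] at hpar
    rw [List.map_cons, List.sum_cons, ← hl, wedge, neg_one_pow_mul_eq_smul k]
    refine leadExp_eq ?_ fun c hc => ?_
    · rw [map_add, map_smul, coeff_add, coeff_smul, coeff_mul_leadExp, add_comm (leadExp y),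
        coeff_mul_leadExp]
      have h3 : (-1 : k) ^ inversions (leadExp y) (leadExp (wedge l)) +
          (-1) ^ (l.length + inversions (leadExp (wedge l)) (leadExp y)) ≠ 0 := by
        rw [Ne, neg_one_pow_add_neg_one_pow h2, Nat.not_odd_iff_even]
        convert hpar using 1
        ring
      convert mul_ne_zero h3 (mul_ne_zero (leadCoeff_ne_zero hy) (leadCoeff_ne_zero hw)) using 1
      rw [smul_eq_mul]
      ring
    · rw [map_add, map_smul, coeff_add, coeff_smul, coeff_mul_of_lt hc, coeff_mul_of_lt, smul_zero,
        add_zero]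
      rwa [add_comm]

variable (k n) in
/-- The element of `W_n` anticommuting with all generators when `n` is even. -/
noncomputable def omega : WAlg k n := wedge (List.ofFn (x k n))

lemma pairwise_ofFn_of_relation {R : Type*} [Ring R] {y : Fin n → R}
    (hy : ∀ i j, i ≠ j → y i * y j + y j * y i = 1) :
    (List.ofFn y).Pairwise fun y z => y * z + z * y = 1 :=
  List.pairwise_ofFn.2 fun i j hij => hy i j hij.ne

lemma map_omega (φ : WAlg k n →ₐ[k] WAlg k n) :
    φ (omega k n) = wedge (List.ofFn fun i => φ (x k n i)) := by
  rw [omega, map_wedge, List.map_ofFn]; rfl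

lemma leadExp_wedge_ofFn (h2 : (2 : k) ≠ 0) {y : Fin n → WAlg k n}
    (hy : ∀ i j, i ≠ j → y i * y j + y j * y i = 1) (h0 : ∀ i, y i ≠ 0 ∧ leadExp (y i) ≠ 0) :
    wedge (List.ofFn y) ≠ 0 ∧ leadExp (wedge (List.ofFn y)) = ∑ i, leadExp (y i) := by
  have := leadExp_wedge h2 (List.ofFn y) (pairwise_ofFn_of_relation hy) (by simpa using h0)
  rwa [List.map_ofFn, List.sum_ofFn] at this

lemma omega_ne_zero (h2 : (2 : k) ≠ 0) : omega k n ≠ 0 :=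
  (leadExp_wedge_ofFn h2 (fun _ _ => relation) fun i => ⟨x_ne_zero i, by simp [leadExp_x]⟩).1

lemma leadExp_omega (h2 : (2 : k) ≠ 0) : leadExp (omega k n) = ∑ i, single i 1 := by
  have := (leadExp_wedge_ofFn (k := k) (n := n) h2 (fun _ _ => relation)
    fun i => ⟨x_ne_zero i, by simp [leadExp_x]⟩).2
  simp only [leadExp_x] at this
  exact this

/-- An element anticommuting with all generators. -/
def AntiCentral (u : WAlg k n) : Prop := ∀ i, u * x k n i + x k n i * u = 0

lemma antiCentral_omega (hn : Even n) : AntiCentral (omega k n) := by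
  exact fun i => wedge_mul_add_mul_wedge
    (pairwise_ofFn_of_relation (y := x k n) fun _ _ => relation) (by simpa using hn) (by simp)

/-- The exponents of the leading monomial of an anticentral element are odd. -/
lemma AntiCentral.odd_leadExp (h2 : (2 : k) ≠ 0) {u : WAlg k n} (hu : u ≠ 0) (h : AntiCentral u)
    (i : Fin n) : Odd (leadExp u i) := by
  -- Anticommuting with `x_j` makes `degree - exponent_j` odd.
  have h1 (j : Fin n) : ∃ m, (leadExp u).degree = m + leadExp u j ∧ Odd m := by
    refine ⟨_, (inversions_single_add j (leadExp u)).symm, ?_⟩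
    have := odd_inversions_of_coeff_eq_zero h2 hu (x_ne_zero j) (by rw [h j, map_zero, coeff_zero])
    rwa [leadExp_x, add_comm] at this
  -- One even exponent makes the degree odd, hence all exponents even, hence the degree even.
  by_contra hi
  rw [Nat.not_odd_iff_even] at hi
  obtain ⟨m, hm, hmo⟩ := h1 i
  have hodd : Odd (leadExp u).degree := hm ▸ hmo.add_even hi
  have heven : Even (leadExp u).degree := by
    rw [Finsupp.degree_eq_sum]
    refine Finset.even_sum _ fun j _ => ?_
    obtain ⟨m', hm', hmo'⟩ := h1 j
    rw [hm', Nat.odd_add] at hodd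
    exact hodd.1 hmo'
  exact (Nat.not_odd_iff_even.2 heven) hodd

lemma commute_x_mul_x_x (j i : Fin n) : Commute (x k n j * x k n j) (x k n i) := by
  rcases eq_or_ne j i with rfl | hij
  · exact (Commute.refl _).mul_left (Commute.refl _)
  · exact sq_commute_of_add_eq_one (relation hij)

/-- Products of the central squares `x_j * x_j` realise every even exponent vector. -/
lemma exists_central_leadExp (b : Fin n →₀ ℕ) :
    ∃ z : WAlg k n, z ≠ 0 ∧ leadExp z = 2 • b ∧ ∀ i, Commute z (x k n i) := by
  induction b using Finsupp.induction_linear with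
  | zero => exact ⟨1, one_ne_zero, by simp [leadExp_one], fun i => Commute.one_left _⟩
  | add a b ha hb =>
    obtain ⟨y, hy, hya, hyc⟩ := ha
    obtain ⟨z, hz, hzb, hzc⟩ := hb
    exact ⟨y * z, mul_ne_zero hy hz, by rw [leadExp_mul hy hz, hya, hzb, smul_add],
      fun i => (hyc i).mul_left (hzc i)⟩
  | single j c =>
    have hj := x_ne_zero (k := k) j
    induction c with
    | zero => exact ⟨1, one_ne_zero, by simp [leadExp_one], fun i => Commute.one_left _⟩
    | succ c ih =>
      obtain ⟨z, hz, hzb, hzc⟩ := ih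
      refine ⟨x k n j * x k n j * z, mul_ne_zero (mul_ne_zero hj hj) hz, ?_,
        fun i => (commute_x_mul_x_x j i).mul_left (hzc i)⟩
      rw [leadExp_mul (mul_ne_zero hj hj) hz, leadExp_mul hj hj, leadExp_x, hzb]
      ext i
      simp [Finsupp.single_apply]
      split_ifs <;> ring

/-- Anticentral elements are multiples of `omega`. -/
lemma AntiCentral.exists_eq_mul_omega (h2 : (2 : k) ≠ 0) (hn : Even n) (u : WAlg k n)
    (h : AntiCentral u) : ∃ z, u = z * omega k n := by
  induction hd : degLex.toSyn (leadExp u) using WellFoundedLT.induction generalizing u with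
  | _ d ih =>
    rcases eq_or_ne u 0 with rfl | hu
    · exact ⟨0, (zero_mul _).symm⟩
    have hω := omega_ne_zero (k := k) (n := n) h2
    -- The leading exponent is `2b + (1, …, 1)`, which is that of `z * omega` for a central `z` with
    -- leading exponent `2b`. Subtracting a multiple lowers the leading exponent and keeps the
    -- element anticentral.
    choose b hb using h.odd_leadExp h2 hu
    obtain ⟨z, hz, hzb, hzc⟩ := exists_central_leadExp (k := k) (Finsupp.equivFunOnFinite.symm b)
    have hzω := mul_ne_zero hz hω
    have hlead : leadExp (z * omega k n) = leadExp u := by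
      rw [leadExp_mul hz hω, leadExp_omega h2, hzb]
      ext i
      simp [hb, Finsupp.single_apply]
    set r : k := leadCoeff u / leadCoeff (z * omega k n) with hr
    have hanti : AntiCentral (u - r • (z * omega k n)) := by
      intro i
      have h1 : z * omega k n * x k n i + x k n i * (z * omega k n) = 0 := by
        rw [← mul_assoc (x k n i), ← (hzc i).eq, mul_assoc, mul_assoc, ← mul_add,
          antiCentral_omega hn i, mul_zero]
      rw [sub_mul, mul_sub, smul_mul_assoc, mul_smul_comm, sub_add_sub_comm, h i, ← smul_add, h1,
        smul_zero, sub_zero]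
    have hex : ∃ y, u - r • (z * omega k n) = y * omega k n := by
      rcases eq_or_ne (u - r • (z * omega k n)) 0 with h0 | h0
      · exact ⟨0, by rw [h0, zero_mul]⟩
      refine ih _ ?_ _ hanti rfl
      rw [← hd]
      by_contra hle
      refine leadCoeff_ne_zero h0 ?_
      rw [leadCoeff, map_sub, map_smul, coeff_sub, coeff_smul]
      rcases (not_lt.1 hle).eq_or_lt with heq | hlt
      · rw [← degLex.toSyn.injective heq, ← hlead, ← leadCoeff, smul_eq_mul, hr,
          div_mul_cancel₀ _ (leadCoeff_ne_zero hzω), hlead, ← leadCoeff, sub_self]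
      · rw [coeff_eq_zero_of_leadExp_lt hlt, coeff_eq_zero_of_leadExp_lt (hlead ▸ hlt), smul_zero,
          sub_zero]
    obtain ⟨y, hy⟩ := hex
    exact ⟨y + r • z, by rw [add_mul, smul_mul_assoc, ← hy, sub_add_cancel]⟩

end WAlg

/-! ### Affine elements and normal elements -/

/-- Off the diagonal each `y i * y j + y j * y i` is `1`, so only squares survive in degree two and
the rest of the quadratic part is a scalar. -/
lemma affine_anticommutator {k A ι : Type*} [CommRing k] [Ring A] [Algebra k A] [Fintype ι]
    {y : ι → A} (hy : ∀ i j, i ≠ j → y i * y j + y j * y i = 1) (β β' : k) (α α' : ι → k) :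
    (algebraMap k A β + ∑ i, α i • y i) * (algebraMap k A β' + ∑ i, α' i • y i) +
        (algebraMap k A β' + ∑ i, α' i • y i) * (algebraMap k A β + ∑ i, α i • y i) =
      ∑ i, (2 * (α i * α' i)) • (y i * y i) + ∑ i, (2 * (β * α' i + β' * α i)) • y i +
        algebraMap k A (2 * (β * β') + ((∑ i, α i) * (∑ i, α' i) - ∑ i, α i * α' i)) := by
  classical
  have h1 : (∑ i, α i • y i) * (∑ i, α' i • y i) + (∑ i, α' i • y i) * (∑ i, α i • y i) =
      ∑ i, (2 * (α i * α' i)) • (y i * y i) +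
        algebraMap k A ((∑ i, α i) * (∑ i, α' i) - ∑ i, α i * α' i) := by
    have h2 (i j : ι) : y i * y j + y j * y i =
        (if i = j then (2 : k) • (y i * y i) - 1 else 0) + 1 := by
      split_ifs with h
      · rw [← h, two_smul, sub_add_cancel]
      · rw [hy i j h, zero_add]
    rw [Finset.sum_mul_sum, Finset.sum_mul_sum,
      Finset.sum_comm (f := fun i j => α' i • y i * α j • y j), ← Finset.sum_add_distrib]
    simp only [← Finset.sum_add_distrib, smul_mul_smul_comm]
    trans ∑ i, ∑ j, (α i * α' j) • ((if i = j then (2 : k) • (y i * y i) - 1 else 0) + 1)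
    · refine Finset.sum_congr rfl fun i _ => Finset.sum_congr rfl fun j _ => ?_
      rw [← h2, smul_add, mul_comm (α' j)]
    · simp only [smul_add, Finset.sum_add_distrib, smul_ite, smul_zero, Finset.sum_ite_eq,
        Finset.mem_univ, if_true, smul_sub, Finset.sum_sub_distrib, smul_smul,
        Algebra.algebraMap_eq_smul_one, sub_smul, Finset.sum_smul, Finset.sum_mul_sum,
        mul_comm (2 : k)]
      abel
  have h3 : ∑ i, (2 * (β * α' i + β' * α i)) • y i =
      (2 * β) • ∑ i, α' i • y i + (2 * β') • ∑ i, α i • y i := by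
    rw [Finset.smul_sum, Finset.smul_sum, ← Finset.sum_add_distrib]
    refine Finset.sum_congr rfl fun i _ => ?_
    rw [smul_smul, smul_smul, ← add_smul]
    congr 1; ring
  rw [map_add (algebraMap k A), h3, eq_sub_of_add_eq h1.symm]
  have h4 (r : k) (z : A) : (2 * r) • z = algebraMap k A r * z + algebraMap k A r * z := by
    rw [two_mul, add_smul, Algebra.smul_def]
  have h5 : algebraMap k A (2 * (β * β')) =
      algebraMap k A β * algebraMap k A β' + algebraMap k A β * algebraMap k A β' := by
    rw [two_mul, map_add, map_mul]
  rw [h4, h4, h5]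
  simp only [add_mul, mul_add]
  rw [← Algebra.commutes β (∑ i, α' i • y i), ← Algebra.commutes β' (∑ i, α i • y i),
    Algebra.commutes β' (algebraMap k A β)]
  abel

lemma exists_mul_eq_of_anticomm {R : Type*} [Ring R] {a b : R} (h : a * b + b * a = 0) :
    ∃ c, c * a = a * b :=
  ⟨-b, (neg_mul _ _).trans (eq_neg_of_add_eq_zero_left h).symm⟩

namespace WAlg

open MvPolynomial Finsupp MonomialOrder

variable {k : Type*} [Field k] {n : ℕ}

lemma normalForm_sum_sq_add_affine (γ δ : Fin n → k) (c : k) :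
    normalForm (∑ i, γ i • (x k n i * x k n i) + ∑ i, δ i • x k n i + algebraMap k _ c) =
      ∑ i, monomial (single i 2) (γ i) + ∑ i, monomial (single i 1) (δ i) + monomial 0 c := by
  simp only [map_add, normalForm_algebraMap, map_sum, map_smul, normalForm_x, normalForm_x_mul_x,
    smul_monomial, smul_eq_mul, mul_one]

lemma coeff_single_two_sum_sq_add_affine (γ δ : Fin n → k) (c : k) (i : Fin n) :
    (normalForm (∑ i, γ i • (x k n i * x k n i) + ∑ i, δ i • x k n i + algebraMap k _ c)).coeff
      (single i 2) = γ i := by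
  classical
  rw [normalForm_sum_sq_add_affine]
  simp [coeff_sum, coeff_monomial, Finsupp.single_eq_single_iff, eq_comm (a := (0 : Fin n →₀ ℕ))]

lemma coeff_single_one_sum_sq_add_affine (γ δ : Fin n → k) (c : k) (i : Fin n) :
    (normalForm (∑ i, γ i • (x k n i * x k n i) + ∑ i, δ i • x k n i + algebraMap k _ c)).coeff
      (single i 1) = δ i := by
  classical
  rw [normalForm_sum_sq_add_affine]
  simp [coeff_sum, coeff_monomial, Finsupp.single_eq_single_iff, eq_comm (a := (0 : Fin n →₀ ℕ))]

lemma affine_eq_smul_x {u : WAlg k n} {β : k} {α : Fin n → k} {i : Fin n}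
    (hu : u = algebraMap k _ β + ∑ j, α j • x k n j) (hβ : β = 0) (hα : ∀ j ≠ i, α j = 0) :
    u = α i • x k n i := by
  rw [hu, hβ, map_zero, zero_add, Finset.sum_eq_single i]
  · intro j _ hj
    rw [hα j hj, zero_smul]
  · simp

lemma smul_x_injective {i j : Fin n} {c d : k} (hc : c ≠ 0) (h : c • x k n i = d • x k n j) :
    i = j ∧ c = d := by
  have h1 := congrArg normalForm h
  rw [map_smul, map_smul, normalForm_x, normalForm_x, smul_monomial, smul_monomial,
    MvPolynomial.monomial_eq_monomial_iff] at h1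
  simp only [smul_eq_mul, mul_one] at h1
  rcases h1 with ⟨h1, h2⟩ | ⟨h1, -⟩
  · exact ⟨Finsupp.single_left_injective one_ne_zero h1, h2⟩
  · exact absurd h1 hc

/-- An affine element with the same square as `x_i` is `± x_i`. -/
lemma eq_smul_x_of_sq (h2 : (2 : k) ≠ 0) {v : WAlg k n} {i : Fin n}
    (hv : leadExp v = single i 1) (hsq : v * v = x k n i * x k n i) :
    ∃ c : k, v = c • x k n i ∧ c * c = 1 := by
  classical
  obtain ⟨β, α, hu, -⟩ := exists_affine_of_degree_le_one (u := v) (by rw [hv]; simp)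
  -- With equal factors the formula computes `2 * v * v`; its coefficients determine the `α j` up to
  -- sign and force `β = 0`.
  have h1 := affine_anticommutator (k := k) (y := x k n) (fun _ _ => relation) β β α α
  rw [← hu, hsq] at h1
  have hn : normalForm (x k n i * x k n i + x k n i * x k n i) = monomial (single i 2) 2 := by
    rw [map_add, normalForm_x_mul_x, ← map_add (monomial _), one_add_one_eq_two]
  have hα (j : Fin n) : 2 * (α j * α j) = if i = j then 2 else 0 := by
    rw [← coeff_single_two_sum_sq_add_affine (fun j => 2 * (α j * α j)), ← h1, hn, coeff_monomial]
    simp [Finsupp.single_eq_single_iff]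
  have hβ (j : Fin n) : 2 * (β * α j + β * α j) = 0 := by
    rw [← coeff_single_one_sum_sq_add_affine _ (fun j => 2 * (β * α j + β * α j)), ← h1, hn,
      coeff_monomial]
    simp [Finsupp.single_eq_single_iff]
  have hi : α i * α i = 1 := by
    have := hα i
    rw [if_pos rfl] at this
    exact mul_left_cancel₀ h2 (by rw [this, mul_one])
  refine ⟨α i, affine_eq_smul_x hu ?_ fun j hj => ?_, hi⟩
  · have := hβ i
    rw [← two_mul] at this
    have h0 : α i ≠ 0 := fun h => by simp [h] at hi
    simpa [h2, h0] using this
  · have := hα j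
    rw [if_neg hj.symm] at this
    simpa [h2] using this

lemma commute_of_forall_commute_x {c : WAlg k n} (h : ∀ i, Commute c (x k n i)) (u : WAlg k n) :
    Commute c u := by
  have hmem : u ∈ Algebra.adjoin k (Set.range (x k n)) := by rw [adjoin_range_x]; trivial
  refine Algebra.adjoin_induction (p := fun u _ => Commute c u) ?_ ?_ ?_ ?_ hmem
  · rintro _ ⟨j, rfl⟩
    exact h j
  · exact fun r => (Algebra.commutes r _).symm
  · exact fun _ _ _ _ => Commute.add_right
  · exact fun _ _ _ _ => Commute.mul_right

lemma commute_x_mul_x (i : Fin n) (u : WAlg k n) : Commute (x k n i * x k n i) u :=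
  commute_of_forall_commute_x (fun j => commute_x_mul_x_x i j) u

lemma neg_one_smul_add_self (R : Type*) {M : Type*} [Ring R] [AddCommGroup M] [Module R M] (v : M) :
    (-1 : R) • v + v = 0 := by
  rw [neg_one_smul, neg_add_cancel]

lemma smul_anticommutator {R A : Type*} [CommRing R] [Ring A] [Algebra R A] (c d : R) {u v : A}
    (h : u * v + v * u = 1) : (c • u) * (d • v) + (d • v) * (c • u) = (c * d) • (1 : A) := by
  rw [smul_mul_smul_comm, smul_mul_smul_comm, mul_comm d, ← smul_add, h]

lemma smul_one_eq_one_iff {c : k} : c • (1 : WAlg k n) = 1 ↔ c = 1 := by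
  rw [← Algebra.algebraMap_eq_smul_one, ← map_one (algebraMap k (WAlg k n))]
  exact (FaithfulSMul.algebraMap_injective k (WAlg k n)).eq_iff

/-- A nonzero normal element commutes with all generators or anticommutes with all of them. -/
lemma commute_or_antiCentral (h2 : (2 : k) ≠ 0) {u : WAlg k n} (hu : u ≠ 0)
    (h : ∀ i, ∃ v, v * u = u * x k n i) : (∀ i, Commute u (x k n i)) ∨ AntiCentral u := by
  choose v hv using h
  have hlead (i : Fin n) : leadExp (v i) = single i 1 := by
    have hne : v i * u ≠ 0 := by rw [hv]; exact mul_ne_zero hu (x_ne_zero i)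
    have := congrArg leadExp (hv i)
    rw [leadExp_mul (left_ne_zero_of_mul hne) hu, leadExp_mul hu (x_ne_zero i), leadExp_x,
      add_comm] at this
    exact add_left_cancel this
  -- The map `x_i ↦ v_i` is conjugation by `u`, so it preserves the relations and fixes the central
  -- squares; thus `v_i = c_i x_i` with `c_i = ±1`, and `c_i c_j = 1` makes the signs equal.
  have hvv (i j : Fin n) : v i * v j * u = u * (x k n i * x k n j) := by
    rw [mul_assoc, hv, ← mul_assoc, hv, mul_assoc]
  have hsq (i : Fin n) : v i * v i = x k n i * x k n i := by
    refine mul_right_cancel₀ hu ?_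
    rw [hvv]
    exact (commute_x_mul_x i u).symm.eq
  choose c hc hcc using fun i => eq_smul_x_of_sq h2 (hlead i) (hsq i)
  have hprod (i j : Fin n) : c i * c j = 1 := by
    rcases eq_or_ne i j with rfl | hij
    · exact hcc i
    · rw [← smul_one_eq_one_iff (n := n), ← smul_anticommutator (c i) (c j) (relation hij), ← hc,
        ← hc]
      refine mul_right_cancel₀ hu ?_
      rw [add_mul, hvv, hvv, ← mul_add, relation hij, mul_one, one_mul]
  by_cases h1 : ∃ i, c i = 1
  · obtain ⟨i, hi⟩ := h1
    left
    intro j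
    have hj : c j = 1 := by simpa [hi] using hprod i j
    change u * x k n j = x k n j * u
    rw [← hv, hc, hj, one_smul]
  · push Not at h1
    right
    intro j
    have hj : c j = -1 := (mul_self_eq_one_iff.1 (hcc j)).resolve_left (h1 j)
    rw [← hv, hc, hj, ← add_mul]
    exact (congrArg (· * u) (neg_one_smul_add_self k (x k n j))).trans (zero_mul u)

/-! ### Signed permutations as automorphisms -/

/-- The automorphism `x_i ↦ ε x_{σ i}`, as an endomorphism. -/
noncomputable def signedPerm (p : Equiv.Perm (Fin n) × ℤˣ) : WAlg k n →ₐ[k] WAlg k n :=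
  lift (fun i => (p.2 : ℤ) • x k n (p.1 i)) fun i j hij => by
    refine (smul_anticommutator (p.2 : ℤ) (p.2 : ℤ) (relation (p.1.injective.ne hij))).trans ?_
    rw [← Units.val_mul, Int.units_mul_self, Units.val_one]
    exact one_smul ℤ _

@[simp] lemma signedPerm_x (p : Equiv.Perm (Fin n) × ℤˣ) (i : Fin n) :
    signedPerm p (x k n i) = (p.2 : ℤ) • x k n (p.1 i) := lift_x _ _ i

variable (k n) in
/-- The action of signed permutations on `W_n` by automorphisms. -/
noncomputable def signedPermHom :
    Equiv.Perm (Fin n) × ℤˣ →* (WAlg k n ≃ₐ[k] WAlg k n) :=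
  -- A monoid homomorphism from a group lands in the units, so inverses need no separate
  -- construction.
  (AlgEquiv.algHomUnitsEquiv k (WAlg k n)).toMonoidHom.comp <| MonoidHom.toHomUnits
    { toFun := signedPerm
      map_one' := algHom_ext fun i => by simp
      map_mul' := fun p q => algHom_ext fun i => by
        simp only [signedPerm_x, AlgHom.mul_apply, Prod.fst_mul, Prod.snd_mul, Units.val_mul,
          Equiv.Perm.mul_apply, map_zsmul]
        rw [mul_comm, mul_smul] }

lemma signedPermHom_x (p : Equiv.Perm (Fin n) × ℤˣ) (i : Fin n) :
    signedPermHom k n p (x k n i) = (p.2 : ℤ) • x k n (p.1 i) := signedPerm_x p i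

lemma zsmul_x (m : ℤ) (i : Fin n) : m • x k n i = (m : k) • x k n i :=
  (Int.cast_smul_eq_zsmul k m _).symm

lemma intCast_units_injective (h2 : (2 : k) ≠ 0) {ε δ : ℤˣ} (h : ((ε : ℤ) : k) = ((δ : ℤ) : k)) :
    ε = δ := by
  have h3 : (1 : k) ≠ -1 := fun h => h2 (by
    rw [← one_add_one_eq_two]; nth_rewrite 2 [h]; exact add_neg_cancel 1)
  rcases Int.units_eq_one_or ε with rfl | rfl <;> rcases Int.units_eq_one_or δ with rfl | rfl <;>
    simp_all

lemma signedPermHom_injective (h2 : (2 : k) ≠ 0) (hn : 0 < n) :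
    Function.Injective (signedPermHom k n) := by
  intro p q hpq
  have h (i : Fin n) : p.1 i = q.1 i ∧ ((p.2 : ℤ) : k) = ((q.2 : ℤ) : k) := by
    have := DFunLike.congr_fun hpq (x k n i)
    rw [signedPermHom_x, signedPermHom_x, zsmul_x, zsmul_x] at this
    refine smul_x_injective ?_ this
    rcases Int.units_eq_one_or p.2 with h | h <;> simp [h]
  exact Prod.ext (Equiv.ext fun i => (h i).1) (intCast_units_injective h2 (h ⟨0, hn⟩).2)

/-! ### Images of `omega` and of the generators under an automorphism -/

/-- Normality of `omega` passes to its image. Were the image central, `omega` would both commute and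
anticommute with a generator, giving `2 * x * omega = 0` in a domain. -/
lemma antiCentral_map_omega (h2 : (2 : k) ≠ 0) (hn : Even n) (hn0 : 0 < n)
    (φ : WAlg k n ≃ₐ[k] WAlg k n) : AntiCentral (φ (omega k n)) := by
  have hω := omega_ne_zero (k := k) (n := n) h2
  have hanti := antiCentral_omega (k := k) hn
  have hnormal (w : WAlg k n) : ∃ w', w' * omega k n = omega k n * w := by
    have hmem : w ∈ Algebra.adjoin k (Set.range (x k n)) := by rw [adjoin_range_x]; trivial
    induction hmem using Algebra.adjoin_induction with
    | mem w hw =>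
      obtain ⟨i, rfl⟩ := hw
      exact exists_mul_eq_of_anticomm (hanti i)
    | algebraMap r => exact ⟨_, Algebra.commutes r _⟩
    | add u v _ _ hu hv =>
      obtain ⟨u', hu⟩ := hu
      obtain ⟨v', hv⟩ := hv
      exact ⟨u' + v', by rw [add_mul, hu, hv, mul_add]⟩
    | mul u v _ _ hu hv =>
      obtain ⟨u', hu⟩ := hu
      obtain ⟨v', hv⟩ := hv
      exact ⟨u' * v', by rw [mul_assoc, hv, ← mul_assoc, hu, mul_assoc]⟩
  refine (commute_or_antiCentral h2 ((map_ne_zero_iff φ φ.injective).2 hω) fun i => ?_).resolve_left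
    fun hc => ?_
  · obtain ⟨w, hw⟩ := hnormal (φ.symm (x k n i))
    exact ⟨φ w, by rw [← map_mul, hw, map_mul, AlgEquiv.apply_symm_apply]⟩
  · have h1 := commute_of_forall_commute_x hc (φ (x k n ⟨0, hn0⟩))
    have h3 : omega k n * x k n ⟨0, hn0⟩ = x k n ⟨0, hn0⟩ * omega k n :=
      φ.injective (by rw [map_mul, map_mul]; exact h1.eq)
    have h4 := hanti ⟨0, hn0⟩
    rw [h3, ← two_smul k, smul_eq_zero] at h4
    exact h4.elim h2 (mul_ne_zero (x_ne_zero _) hω)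

/-- Automorphisms preserve the leading exponent of `omega`. -/
lemma leadExp_map_omega (h2 : (2 : k) ≠ 0) (hn : Even n) (hn0 : 0 < n)
    (φ : WAlg k n ≃ₐ[k] WAlg k n) : leadExp (φ (omega k n)) = leadExp (omega k n) := by
  have hω := omega_ne_zero (k := k) (n := n) h2
  obtain ⟨z, hz⟩ := (antiCentral_map_omega h2 hn hn0 φ).exists_eq_mul_omega h2 hn
  obtain ⟨w, hw⟩ := (antiCentral_map_omega h2 hn hn0 φ.symm).exists_eq_mul_omega h2 hn
  -- Both sides agree after multiplication by `omega`: `φ w * z * omega = φ (w * omega) = φ (φ.symm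
  -- omega)`.
  have h1 : φ w * z = 1 := by
    refine mul_right_cancel₀ hω ?_
    rw [mul_assoc, ← hz, ← map_mul, ← hw, AlgEquiv.apply_symm_apply, one_mul]
  have hne : φ w * z ≠ 0 := h1 ▸ one_ne_zero
  have h3 := congrArg leadExp h1
  rw [leadExp_mul (left_ne_zero_of_mul hne) (right_ne_zero_of_mul hne), leadExp_one,
    add_eq_zero] at h3
  rw [hz, leadExp_mul (right_ne_zero_of_mul hne) hω, h3.2, zero_add]

/-- The `n` leading exponents are nonzero and sum to `(1, …, 1)`, of degree `n`. So each has degree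
one, and every unit vector must occur. -/
lemma exists_leadExp_map_x (h2 : (2 : k) ≠ 0) (hn : Even n) (hn0 : 0 < n)
    (φ : WAlg k n ≃ₐ[k] WAlg k n) :
    ∃ σ : Equiv.Perm (Fin n), ∀ i, leadExp (φ (x k n i)) = single (σ i) 1 := by
  have hne (i : Fin n) : φ (x k n i) ≠ 0 := (map_ne_zero_iff φ φ.injective).2 (x_ne_zero i)
  have hlead (i : Fin n) : leadExp (φ (x k n i)) ≠ 0 := by
    intro h
    obtain ⟨c, hc⟩ := eq_algebraMap_of_leadExp_eq_zero h
    rw [← φ.commutes] at hc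
    have h1 := congrArg normalForm (φ.injective hc)
    rw [normalForm_x, normalForm_algebraMap, MvPolynomial.monomial_eq_monomial_iff] at h1
    simp at h1
  have hrel (i j : Fin n) (hij : i ≠ j) :
      φ (x k n i) * φ (x k n j) + φ (x k n j) * φ (x k n i) = 1 := by
    rw [← map_mul, ← map_mul, ← map_add, relation hij, map_one]
  have hsum : ∑ i, leadExp (φ (x k n i)) = ∑ i, single i 1 := by
    rw [← leadExp_omega h2, ← leadExp_map_omega h2 hn hn0 φ,
      ← (leadExp_wedge_ofFn h2 hrel fun i => ⟨hne i, hlead i⟩).2]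
    exact congrArg leadExp (map_omega φ.toAlgHom).symm
  have hdeg (i : Fin n) : (leadExp (φ (x k n i))).degree = 1 := by
    have h1 : ∀ i ∈ Finset.univ, 1 ≤ (leadExp (φ (x k n i))).degree := fun i _ =>
      Nat.one_le_iff_ne_zero.2 ((degree_eq_zero_iff _).not.2 (hlead i))
    have h3 := congrArg Finsupp.degree hsum
    simp only [map_sum, Finsupp.degree_single] at h3
    exact ((Finset.sum_eq_sum_iff_of_le h1).1 h3.symm i (Finset.mem_univ i)).symm
  have hex (i : Fin n) : ∃ j, single j 1 = leadExp (φ (x k n i)) := by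
    have : leadExp (φ (x k n i)) ∈ Set.range (fun a : Fin n ↦ Finsupp.single a 1) := by
      rw [Finsupp.range_single_one]; exact hdeg i
    exact this
  choose π hπ using hex
  have hsurj : Function.Surjective π := by
    intro l
    by_contra! h
    simp only [← hπ] at hsum
    have := DFunLike.congr_fun hsum l
    simp [Finsupp.single_apply, h] at this
  exact ⟨Equiv.ofBijective π ⟨Finite.injective_iff_surjective.2 hsurj, hsurj⟩, fun i => (hπ i).symm⟩

lemma exists_map_x_eq_smul (h2 : (2 : k) ≠ 0) (hn : Even n) (hn1 : 1 < n)
    (φ : WAlg k n ≃ₐ[k] WAlg k n) :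
    ∃ (σ : Equiv.Perm (Fin n)) (c : Fin n → k), (∀ i, φ (x k n i) = c i • x k n (σ i)) ∧
      ∀ i j, i ≠ j → c i * c j = 1 := by
  classical
  obtain ⟨σ, hσ⟩ := exists_leadExp_map_x h2 hn (by omega) φ
  choose β α hφ hα using fun i => exists_affine_of_degree_le_one (u := φ (x k n i))
    (by rw [hσ i]; simp)
  have hrel (i j : Fin n) (hij : i ≠ j) :
      φ (x k n i) * φ (x k n j) + φ (x k n j) * φ (x k n i) = 1 := by
    rw [← map_mul, ← map_mul, ← map_add, relation hij, map_one]
  have hα0 (i : Fin n) : α i (σ i) ≠ 0 := by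
    rw [hα, ← hσ]
    exact leadCoeff_ne_zero ((map_ne_zero_iff φ φ.injective).2 (x_ne_zero i))
  have haff (i j : Fin n) := affine_anticommutator (k := k) (y := x k n) (fun _ _ => relation)
    (β i) (β j) (α i) (α j)
  have hquad (i j l : Fin n) (hij : i ≠ j) : 2 * (α i l * α j l) = 0 := by
    rw [← coeff_single_two_sum_sq_add_affine (fun l => 2 * (α i l * α j l)), ← haff, ← hφ, ← hφ,
      hrel i j hij, normalForm_one, coeff_monomial, if_neg]
    exact fun h => by simpa using DFunLike.congr_fun h l
  have hlin (i j l : Fin n) (hij : i ≠ j) : 2 * (β i * α j l + β j * α i l) = 0 := by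
    rw [← coeff_single_one_sum_sq_add_affine _ (fun l => 2 * (β i * α j l + β j * α i l)), ← haff,
      ← hφ, ← hφ, hrel i j hij, normalForm_one, coeff_monomial, if_neg]
    exact fun h => by simpa using DFunLike.congr_fun h l
  -- Column `l` has the nonzero entry `α (σ.symm l) l`, so `hquad` kills all its other entries.
  have hoff (j l : Fin n) (hl : l ≠ σ j) : α j l = 0 := by
    have hij : σ.symm l ≠ j := fun h => hl (by rw [← h, Equiv.apply_symm_apply])
    have := hquad _ j l hij
    have h0 := hα0 (σ.symm l)
    rw [Equiv.apply_symm_apply] at h0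
    simpa [h2, h0] using this
  -- For any `j ≠ i`, the coefficient of `x_{σ j}` reduces to `2 * β i * α j (σ j)`.
  have hβ (i : Fin n) : β i = 0 := by
    have : Nontrivial (Fin n) := Fin.nontrivial_iff_two_le.2 hn1
    obtain ⟨j, hj⟩ := exists_ne i
    have := hlin i j (σ j) hj.symm
    rw [hoff i (σ j) (σ.injective.ne hj)] at this
    simpa [h2, hα0] using this
  have hx (i : Fin n) : φ (x k n i) = α i (σ i) • x k n (σ i) :=
    affine_eq_smul_x (hφ i) (hβ i) fun l hl => hoff i l hl
  refine ⟨σ, fun i => α i (σ i), hx, fun i j hij => ?_⟩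
  rw [← smul_one_eq_one_iff (n := n),
    ← smul_anticommutator (α i (σ i)) (α j (σ j)) (relation (σ.injective.ne hij)), ← hx, ← hx,
    hrel i j hij]

/-- For distinct `i, j, l`, `(c i * c j) * (c i * c l) = 1` and `c j * c l = 1` give `c i * c i =
1`. Two indices would not suffice, since they allow `c` and `c⁻¹`. -/
lemma exists_sign_of_pairwise_mul_eq_one (hn : 3 ≤ n) {c : Fin n → k}
    (hc : ∀ i j, i ≠ j → c i * c j = 1) : ∃ ε : ℤˣ, ∀ i, c i = ((ε : ℤ) : k) := by
  have hsq (i : Fin n) : c i * c i = 1 := by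
    obtain ⟨j, hj⟩ : ∃ j, j ∉ ({i} : Finset (Fin n)) := by
      refine Finset.exists_mem_notMem_of_card_lt_card (t := Finset.univ) ?_ |>.imp fun _ h => h.2
      simp; omega
    obtain ⟨l, hl⟩ : ∃ l, l ∉ ({i, j} : Finset (Fin n)) := by
      refine Finset.exists_mem_notMem_of_card_lt_card (t := Finset.univ) ?_ |>.imp fun _ h => h.2
      refine Finset.card_le_two.trans_lt ?_
      simp; omega
    simp only [Finset.mem_singleton, Finset.mem_insert, not_or] at hj hl
    have h1 := hc i j (Ne.symm hj)
    have h2 := hc i l (Ne.symm hl.1)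
    have h3 := hc j l (Ne.symm hl.2)
    linear_combination (c i * c l) * h1 + h2 - c i * c i * h3
  have heq (i j : Fin n) : c i = c j := by
    rcases eq_or_ne i j with rfl | hij
    · rfl
    · linear_combination c j * hsq i - c i * hc i j hij
  let i₀ : Fin n := ⟨0, by omega⟩
  rcases mul_self_eq_one_iff.1 (hsq i₀) with h | h
  · exact ⟨1, fun i => by rw [heq i i₀, h]; simp⟩
  · exact ⟨-1, fun i => by rw [heq i i₀, h]; simp⟩

lemma signedPermHom_surjective (h2 : (2 : k) ≠ 0) (hn : Even n) (hn3 : 3 ≤ n) :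
    Function.Surjective (signedPermHom k n) := by
  intro φ
  obtain ⟨σ, c, hφ, hc⟩ := exists_map_x_eq_smul h2 hn (by omega) φ
  obtain ⟨ε, hε⟩ := exists_sign_of_pairwise_mul_eq_one hn3 hc
  refine ⟨(σ, ε), AlgEquiv.coe_toAlgHom_injective (algHom_ext fun i => ?_)⟩
  change signedPermHom k n (σ, ε) (x k n i) = φ (x k n i)
  rw [signedPermHom_x, hφ, hε, zsmul_x]

end WAlg

theorem theorem0p1 (k : Type*) [Field k] (hk : ringChar k ≠ 2)
    (n : ℕ) (hn : 4 ≤ n) (hn_even : Even n) :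
    ∃ Φ : Equiv.Perm (Fin n) × ℤˣ ≃* (WAlg k n ≃ₐ[k] WAlg k n),
      ∀ (σ : Equiv.Perm (Fin n)) (ε : ℤˣ) (i : Fin n),
        Φ (σ, ε) (WAlg.x k n i) = (ε : ℤ) • WAlg.x k n (σ i) := by
  have h2 : (2 : k) ≠ 0 := Ring.two_ne_zero hk
  exact ⟨MulEquiv.ofBijective (WAlg.signedPermHom k n)
    ⟨WAlg.signedPermHom_injective h2 (by omega),
      WAlg.signedPermHom_surjective h2 hn_even (by omega)⟩,
    fun σ ε i => WAlg.signedPermHom_x (σ, ε) i⟩
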